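/- Let $Z$ be a smooth real Banach manifold with an involutive diffeomorphism $z\mapsto z^{-*}$, and let $\Pi\colon D\to Z$ be a smooth vector bundle whose typical fibre is a complex Banach space, endowed with a like-Hermitian structure: a family of pairings $(\cdot\mid\cdot)_{z,z^{-*}}\colon D_z\times D_{z^{-*}}\to\mathbb C$ ($z\in Z$) that are continuous, linear in the first and antilinear in the second variable, induce isomorphisms of Banach spaces from $D_z$ onto the space of bounded antilinear functionals on $D_{z^{-*}}$ and (antilinearly) from $D_{z^{-*}}$ onto the dual $D_z^*$, satisfy $\overline{(\xi\mid\eta)}_{z,z^{-*}}=(\eta\mid\xi)_{z^{-*},z}$, and depend smoothly on $z$ in local trivializations. Let $K$ be a reproducing $(-*)$-kernel on $\Pi$, i.e. a family of bounded operators $K(s,t)\colon D_t\to D_s$ ($s,t\in Z$) with $$\sum_{j,l=1}^n\bigl(K(t_l,t_j^{-*})\eta_j\mid\eta_l\bigr)_{t_l,t_l^{-*}}\ge 0\qquad (n\ge1,\ t_j\in Z,\ \eta_j\in D_{t_j^{-*}}).$$ For $\xi\in D_s$ let $K_\xi:=K(\cdot,s)\xi$, a section of $\Pi$. Let $\mathcal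 H^K$ be the Hilbert space completion of $\operatorname{span}\{K_\xi\mid\xi\in D\}$ for the scalar product determined by $(K_\eta\mid K_\xi)=(K(s^{-*},t)\eta\mid\xi)_{s^{-*},s}$ for $\xi\in D_s$, $\eta\in D_t$. Let $\widehat K\colon D\to\mathcal H^K$, $\widehat K(\xi)=K_\xi$. Let $\mathrm{Gr}(\mathcal H^K)$ be the set of closed linear subspaces of $\mathcal H^K$, with tautological bundle $\mathcal T(\mathcal H^K)=\{(\mathcal S,x)\mid \mathcal S\in\mathrm{Gr}(\mathcal H^K),\,x\in\mathcal S\}\to\mathrm{Gr}(\mathcal H^K)$, and let $\zeta_K\colon Z\to\mathrm{Gr}(\mathcal H^K)$, $\zeta_K(s)=\overline{\widehat K(D_s)}$. Let $\Lambda_K\colon L_K\to Z$ be the pull-back $\zeta_K^*\mathcal T(\mathcal H^K)$, that is, $L_K=\{(s,x)\in Z\times\mathcal H^K\mid x\in\zeta_K(s)\}$, $\Lambda_K(s,x)=s$, and let $\check K\colon D\to L_K$, $\check K(\xi)=(\Pi(\xi),\widehat K(\xi))$. Assume that $K(s,s)\colon D_s\to D_s$ is invertible for every $s\in Z$. Then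 $(\check K,\mathrm{id}_Z)$ is an (algebraic) isomorphism between the bundles $\Pi\colon D\to Z$ and $\Lambda_K\colon L_K\to Z$: it is a morphism, meaning that it maps each fibre $D_s$ into $\zeta_K(s)$ by a bounded linear operator, and it has a two-sided inverse which is a morphism in the same sense. Hence $\Pi$ is isomorphic to the pull-back bundle $\zeta_K^*\mathcal T(\mathcal H^K)\to Z$. -/

import Mathlib

open Bundle Manifold
open scoped ContDiff ComplexOrder ComplexConjugate InnerProductSpace

noncomputable section

namespace LikeHerm

/-- A sesquilinear form (linear in the first, antilinear in the second variable) on a pair of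
complex topological vector spaces is a *strong duality pairing* if it is continuous and both
induced maps, into the space of continuous antilinear functionals on `Y` and into the space of
continuous linear functionals on `X`, are isomorphisms of topological vector spaces. In the second
map the antilinearity of `y ↦ B x y` is expressed by semilinearity of the equivalence. -/
structure IsStrongDualityPairing {X Y : Type*}
    [AddCommGroup X] [Module ℂ X] [TopologicalSpace X]
    [AddCommGroup Y] [Module ℂ Y] [TopologicalSpace Y]
    (B : X →ₗ[ℂ] Y →ₗ⋆[ℂ] ℂ) : Prop where
  continuous : Continuous fun p : X × Y => B p.1 p.2
  left : ∃ T : X ≃L[ℂ] (Y →L⋆[ℂ] ℂ), ∀ x y, T x y = B x y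
  right : ∃ T : Y ≃L⋆[ℂ] (X →L[ℂ] ℂ), ∀ y x, T y x = B x y

section

variable {EB : Type*} [NormedAddCommGroup EB] [NormedSpace ℝ EB]
  {Z : Type*} [TopologicalSpace Z] [ChartedSpace EB Z]
  {F : Type*} [NormedAddCommGroup F] [NormedSpace ℂ F]
  {D : Z → Type*} [∀ z, AddCommGroup (D z)] [∀ z, Module ℂ (D z)]
  [∀ z, TopologicalSpace (D z)] [TopologicalSpace (TotalSpace F D)] [FiberBundle F D]

variable (EB F D) in
/-- A like-Hermitian structure on the bundle `Π : D → Z` with typical fibre `F` over the manifold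
`Z` modelled on `EB`, together with the involutive diffeomorphism `inv` (written `z ↦ z^{-*}`) of
the base. The pairing `(· ∣ ·)_{z, z^{-*}}` is `pairing z w h` where `h : w = inv z`; carrying the
equation makes it possible to speak of the pairing of the fibres over `inv z` and `z`, since
`inv (inv z) = z` is not a definitional equality. Smoothness is over the reals. -/
structure LikeHermitianStructure where
  /-- the involution of the base -/
  inv : Z → Z
  inv_inv : ∀ z, inv (inv z) = z
  contMDiff_inv : ContMDiff 𝓘(ℝ, EB) 𝓘(ℝ, EB) ∞ inv
  /-- the family of pairings -/
  pairing : ∀ z w : Z, w = inv z → D z →ₗ[ℂ] D w →ₗ⋆[ℂ] ℂ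
  strong : ∀ (z w : Z) (h : w = inv z), IsStrongDualityPairing (pairing z w h)
  conj_pairing : ∀ (z w : Z) (h : w = inv z) (h' : z = inv w) (ξ : D z) (η : D w),
    conj (pairing z w h ξ η) = pairing w z h' η ξ
  smooth : ∀ (e e' : Trivialization F (π F D))
    [MemTrivializationAtlas e] [MemTrivializationAtlas e'],
    ContMDiffOn (𝓘(ℝ, EB).prod 𝓘(ℝ, F × F)) 𝓘(ℝ, ℂ) ∞
      (fun p : Z × (F × F) =>
        pairing p.1 (inv p.1) rfl (e.symm p.1 p.2.1) (e'.symm (inv p.1) p.2.2))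
      ((e.baseSet ∩ inv ⁻¹' e'.baseSet) ×ˢ Set.univ)

/-- A reproducing `(-*)`-kernel on a like-Hermitian bundle: a (not necessarily continuous) section
of `Hom(p₂^* Π, p₁^* Π)`, i.e. a family of bounded operators `K s t : D_t → D_s`, which is
`(-*)`-positive definite: `∑_{j,l} (K(t_l, t_j^{-*}) η_j ∣ η_l)_{t_l, t_l^{-*}} ≥ 0` for
`η_j ∈ D_{t_j^{-*}}`. Here `s j` stands for `t_j^{-*}`, and `0 ≤` on complex numbers means real and
nonnegative. -/
structure ReproducingKernel (L : LikeHermitianStructure EB F D) where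
  /-- the kernel `K(s,t) : D_t → D_s` -/
  toFun : ∀ s t : Z, D t →L[ℂ] D s
  posDef : ∀ (n : ℕ) (t s : Fin n → Z) (h : ∀ j, s j = L.inv (t j)) (η : ∀ j, D (s j)),
    0 ≤ ∑ j, ∑ l, L.pairing (t l) (s l) (h l) (toFun (t l) (s j) (η j)) (η l)

namespace ReproducingKernel

variable {L : LikeHermitianStructure EB F D} (K : ReproducingKernel L)

/-- The section `K_ξ = K(·, Π(ξ)) ξ` of `Π`. -/
def sec (ξ : TotalSpace F D) : ∀ z, D z := fun z => K.toFun z ξ.proj ξ.snd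

/-- `H₀^K`, the linear span of the sections `K_ξ` in the space of all sections of `Π`. -/
def H0 : Submodule ℂ (∀ z, D z) := Submodule.span ℂ (Set.range K.sec)

/-- The section `∑ a_ξ K_ξ` given by a finite family of coefficients. -/
def comb : (TotalSpace F D →₀ ℂ) →ₗ[ℂ] (∀ z, D z) := Finsupp.linearCombination ℂ K.sec

/-- `(K_η ∣ K_ξ) = (K(s^{-*}, t) η ∣ ξ)_{s^{-*}, s}` for `ξ ∈ D_s`, `η ∈ D_t`, extended to finite
combinations. As always for `inner` in Mathlib, it is antilinear in the first argument. -/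
def form (p q : TotalSpace F D →₀ ℂ) : ℂ :=
  p.sum fun ξ a => q.sum fun η b => conj a * b *
    L.pairing (L.inv ξ.proj) ξ.proj (L.inv_inv _).symm
      (K.toFun (L.inv ξ.proj) η.proj η.snd) ξ.snd

lemma form_eq (p q : TotalSpace F D →₀ ℂ) :
    K.form p q = p.sum fun ξ a => conj a *
      L.pairing (L.inv ξ.proj) ξ.proj (L.inv_inv _).symm (K.comb q (L.inv ξ.proj)) ξ.snd := by
  unfold form
  refine Finsupp.sum_congr fun ξ _ => ?_
  have : K.comb q (L.inv ξ.proj) =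
      q.sum fun η b => b • K.toFun (L.inv ξ.proj) η.proj η.snd := by
    simp [comb, Finsupp.linearCombination_apply, Finsupp.sum, sec]
  rw [this]
  simp only [Finsupp.sum, map_sum, map_smul, LinearMap.sum_apply, LinearMap.smul_apply,
    Finset.mul_sum, smul_eq_mul, mul_assoc]

lemma form_add_left (p p' q : TotalSpace F D →₀ ℂ) :
    K.form (p + p') q = K.form p q + K.form p' q := by
  rw [form_eq, form_eq, form_eq, Finsupp.sum_add_index'] <;> intros <;> simp [add_mul]

lemma form_smul_left (c : ℂ) (p q : TotalSpace F D →₀ ℂ) :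
    K.form (c • p) q = conj c * K.form p q := by
  rw [form_eq, form_eq, Finsupp.sum_smul_index']
  · simp [Finsupp.sum, Finset.mul_sum, mul_assoc]
  · simp

lemma form_add_right (p q q' : TotalSpace F D →₀ ℂ) :
    K.form p (q + q') = K.form p q + K.form p q' := by
  simp [form_eq, Finsupp.sum, mul_add, Finset.sum_add_distrib]

lemma form_smul_right (c : ℂ) (p q : TotalSpace F D →₀ ℂ) :
    K.form p (c • q) = c * K.form p q := by
  simp [form_eq, Finsupp.sum, Finset.mul_sum, mul_left_comm]

lemma form_self_nonneg (p : TotalSpace F D →₀ ℂ) : 0 ≤ K.form p p := by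
  classical
  let e := p.support.equivFin
  have h := K.posDef p.support.card
    (fun j => L.inv (e.symm j).1.proj) (fun j => (e.symm j).1.proj)
    (fun j => (L.inv_inv _).symm) (fun j => p (e.symm j).1 • (e.symm j).1.snd)
  have h2 : K.form p p = ∑ l : Fin p.support.card, ∑ j : Fin p.support.card,
      L.pairing (L.inv (e.symm l).1.proj) (e.symm l).1.proj (L.inv_inv _).symm
        (K.toFun (L.inv (e.symm l).1.proj) (e.symm j).1.proj (p (e.symm j).1 • (e.symm j).1.snd))
        (p (e.symm l).1 • (e.symm l).1.snd) := by
    unfold form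
    simp only [Finsupp.sum]
    rw [← Finset.sum_coe_sort, ← e.symm.sum_comp]
    refine Finset.sum_congr rfl fun l _ => ?_
    rw [← Finset.sum_coe_sort, ← e.symm.sum_comp]
    refine Finset.sum_congr rfl fun j _ => ?_
    simp [mul_assoc]
  rw [h2, Finset.sum_comm]
  exact h

lemma form_conj_symm (p q : TotalSpace F D →₀ ℂ) : conj (K.form q p) = K.form p q := by
  have im (r) : (K.form r r).im = 0 := (Complex.le_def.1 (K.form_self_nonneg r)).2.symm
  have h1 := im (p + q)
  have h2 := im (p + Complex.I • q)
  have hp := im p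
  have hq := im q
  simp only [form_add_left, form_add_right, form_smul_left, form_smul_right, Complex.conj_I,
    Complex.add_re, Complex.add_im, Complex.mul_im, Complex.mul_re, Complex.neg_re,
    Complex.neg_im, Complex.I_re, Complex.I_im] at h1 h2
  apply Complex.ext
  · simp only [Complex.conj_re]; linarith
  · simp only [Complex.conj_im]; linarith

lemma form_congr {p p' q q' : TotalSpace F D →₀ ℂ} (hp : K.comb p = K.comb p')
    (hq : K.comb q = K.comb q') : K.form p q = K.form p' q' := by
  have key (r) {s s'} (h : K.comb s = K.comb s') : K.form r s = K.form r s' := by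
    rw [form_eq, form_eq, h]
  rw [key p hq, ← form_conj_symm, key q' hp, form_conj_symm]

lemma comb_eq_zero_of_form {p : TotalSpace F D →₀ ℂ} (h : K.form p p = 0) : K.comb p = 0 := by
  have hz (x : TotalSpace F D →₀ ℂ) : K.form x p = 0 := by
    by_contra hc
    set c := K.form x p with hcdef
    have hcs : K.form p x = conj c := (K.form_conj_symm p x).symm
    have hpos : 0 < Complex.normSq c := Complex.normSq_pos.2 hc
    obtain ⟨n, hn⟩ := exists_nat_gt ((K.form x x).re / Complex.normSq c)
    rw [div_lt_iff₀ hpos] at hn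
    have := (Complex.le_def.1 (K.form_self_nonneg (x + (-(n : ℂ) * conj c) • p))).1
    simp only [form_add_left, form_add_right, form_smul_left, form_smul_right, h, hcs,
      ← hcdef, map_mul, map_neg, Complex.conj_conj, mul_zero, add_zero,
      mul_assoc, Complex.mul_conj, mul_comm (conj c) c, neg_mul, Complex.zero_re,
      Complex.add_re, Complex.neg_re, ← Complex.ofReal_natCast, ← Complex.ofReal_mul,
      Complex.ofReal_re, Complex.conj_ofReal] at this
    have hn0 : (0 : ℝ) ≤ n := Nat.cast_nonneg n
    nlinarith
  funext z
  have hinj : Function.Injective (L.pairing z (L.inv z) rfl) := by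
    obtain ⟨T, hT⟩ := (L.strong z (L.inv z) rfl).left
    intro a b hab
    apply T.injective
    ext y
    rw [hT, hT, hab]
  apply hinj
  rw [Pi.zero_apply, map_zero]
  ext η
  have h1 := hz (Finsupp.single ⟨L.inv z, η⟩ 1)
  rw [form_eq, Finsupp.sum_single_index (by simp)] at h1
  have tr : ∀ (w : Z) (hw : L.inv z = L.inv w) (hwz : w = z),
      L.pairing w (L.inv z) hw (K.comb p w) η = 0 →
      L.pairing z (L.inv z) rfl (K.comb p z) η = 0 := by
    intro w hw hwz h; subst hwz; exact h
  exact tr _ _ (L.inv_inv z) (by simpa using h1)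

/-- `H₀^K` as a pre-Hilbert space (a copy of `H0` without the topology of pointwise convergence). -/
def PreHilbert : Type _ := K.H0

instance : AddCommGroup K.PreHilbert := inferInstanceAs (AddCommGroup K.H0)
instance : Module ℂ K.PreHilbert := inferInstanceAs (Module ℂ K.H0)

lemma exists_rep (f : K.PreHilbert) : ∃ p, K.comb p = f.1 :=
  (Finsupp.mem_span_range_iff_exists_finsupp.1 f.2)

/-- Some finite combination `∑ a_ξ K_ξ` representing `f`. -/
def rep (f : K.PreHilbert) : TotalSpace F D →₀ ℂ := (K.exists_rep f).choose

lemma comb_rep (f : K.PreHilbert) : K.comb (K.rep f) = f.1 := (K.exists_rep f).choose_spec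

/-- The scalar product on `H₀^K`; it does not depend on the representations. -/
@[reducible] def core : InnerProductSpace.Core ℂ K.PreHilbert where
  inner f g := K.form (K.rep f) (K.rep g)
  conj_inner_symm _ _ := K.form_conj_symm _ _
  re_inner_nonneg _ := (Complex.le_def.1 (K.form_self_nonneg _)).1
  add_left f g h := by
    rw [← form_add_left]
    refine K.form_congr ?_ rfl
    rw [map_add, comb_rep, comb_rep, comb_rep]; rfl
  smul_left f g c := by
    rw [← form_smul_left]
    refine K.form_congr ?_ rfl
    rw [map_smul, comb_rep, comb_rep]; rfl
  definite f hf := Subtype.ext (by rw [← comb_rep]; exact K.comb_eq_zero_of_form hf)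

instance : NormedAddCommGroup K.PreHilbert := K.core.toNormedAddCommGroup
instance : InnerProductSpace ℂ K.PreHilbert := InnerProductSpace.ofCore K.core.toCore

/-- `K_ξ` as an element of `H₀^K`. -/
def preSec (ξ : TotalSpace F D) : K.PreHilbert :=
  ⟨K.sec ξ, Submodule.subset_span (Set.mem_range_self ξ)⟩

/-- The defining formula of the scalar product of `H₀^K`. -/
lemma inner_preSec (ξ η : TotalSpace F D) :
    ⟪K.preSec ξ, K.preSec η⟫_ℂ = L.pairing (L.inv ξ.proj) ξ.proj (L.inv_inv _).symm
      (K.toFun (L.inv ξ.proj) η.proj η.snd) ξ.snd := by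
  have h (ξ) : K.comb (K.rep (K.preSec ξ)) = K.comb (Finsupp.single ξ 1) := by
    rw [comb_rep]; simp [comb, preSec]
  change K.form _ _ = _
  rw [K.form_congr (h ξ) (h η)]
  simp [form]

/-- The reproducing kernel Hilbert space `H^K`, the completion of `H₀^K`. -/
abbrev RKHS : Type _ := UniformSpace.Completion K.PreHilbert

/-- `K̂ : D → H^K`, `ξ ↦ K_ξ`. -/
def hat (ξ : TotalSpace F D) : K.RKHS := (K.preSec ξ : K.PreHilbert)

/-- The restriction of `K̂` to the fibre `D_s`, as a linear map. -/
def hatFiber (s : Z) : D s →ₗ[ℂ] K.RKHS where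
  toFun ξ := K.hat ⟨s, ξ⟩
  map_add' ξ η := by
    rw [hat, hat, hat, ← UniformSpace.Completion.coe_add]
    congr 1
    exact Subtype.ext (funext fun z => map_add (K.toFun z s) ξ η)
  map_smul' c ξ := by
    rw [hat, hat, RingHom.id_apply, ← UniformSpace.Completion.coe_smul]
    congr 1
    exact Subtype.ext (funext fun z => map_smul (K.toFun z s) c ξ)

end ReproducingKernel

end

/-- The Grassmannian of all closed linear subspaces. -/
abbrev Gr (H : Type*) [NormedAddCommGroup H] [InnerProductSpace ℂ H] : Type _ :=
  ClosedSubmodule ℂ H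

/-- The tautological bundle over the Grassmannian: the fibre over `S` is `S` itself, so that its
total space is `T(H) = {(S, x) ∣ x ∈ S}`, with projection `(S, x) ↦ S`. -/
abbrev Taut (H : Type*) [NormedAddCommGroup H] [InnerProductSpace ℂ H] (S : Gr H) : Type _ :=
  S.toSubmodule

/-- An (algebraic) morphism `(δ, ζ)` between bundles of topological vector spaces: `δ` maps the
fibre over `z` to the fibre over `ζ z` by a bounded linear operator, for every `z`. No continuity
or smoothness in `z` is required. -/
def IsBundleMorphism {B B' F F' : Type*} {E : B → Type*} {E' : B' → Type*}
    [∀ b, AddCommGroup (E b)] [∀ b, Module ℂ (E b)] [∀ b, TopologicalSpace (E b)]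
    [∀ b, AddCommGroup (E' b)] [∀ b, Module ℂ (E' b)] [∀ b, TopologicalSpace (E' b)]
    (δ : TotalSpace F E → TotalSpace F' E') (ζ : B → B') : Prop :=
  ∀ b, ∃ T : E b →L[ℂ] E' (ζ b), ∀ ξ : E b, δ ⟨b, ξ⟩ = ⟨ζ b, T ξ⟩

/-- An (algebraic) isomorphism of bundles: a morphism with a two-sided inverse morphism. -/
def IsBundleIso {B B' F F' : Type*} {E : B → Type*} {E' : B' → Type*}
    [∀ b, AddCommGroup (E b)] [∀ b, Module ℂ (E b)] [∀ b, TopologicalSpace (E b)]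
    [∀ b, AddCommGroup (E' b)] [∀ b, Module ℂ (E' b)] [∀ b, TopologicalSpace (E' b)]
    (δ : TotalSpace F E → TotalSpace F' E') (ζ : B → B') : Prop :=
  IsBundleMorphism δ ζ ∧ ∃ (δ' : TotalSpace F' E' → TotalSpace F E) (ζ' : B' → B),
    IsBundleMorphism δ' ζ' ∧
      Function.LeftInverse δ' δ ∧ Function.RightInverse δ' δ ∧
      Function.LeftInverse ζ' ζ ∧ Function.RightInverse ζ' ζ

namespace ReproducingKernel

variable {EB : Type*} [NormedAddCommGroup EB] [NormedSpace ℝ EB]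
  {Z : Type*} [TopologicalSpace Z] [ChartedSpace EB Z]
  {F : Type*} [NormedAddCommGroup F] [NormedSpace ℂ F]
  {D : Z → Type*} [∀ z, AddCommGroup (D z)] [∀ z, Module ℂ (D z)]
  [∀ z, TopologicalSpace (D z)] [TopologicalSpace (TotalSpace F D)] [FiberBundle F D]
  {L : LikeHermitianStructure EB F D} (K : ReproducingKernel L)

/-- `ζ_K : Z → Gr(H^K)`, `ζ_K(s)` the closure of `K̂(D_s)`. -/
def zeta (s : Z) : Gr K.RKHS := (LinearMap.range (K.hatFiber s)).closure

lemma hat_mem_zeta (ξ : TotalSpace F D) : K.hat ξ ∈ (K.zeta ξ.proj).toSubmodule :=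
  Submodule.le_topologicalClosure (LinearMap.range (K.hatFiber ξ.proj)) ⟨ξ.snd, rfl⟩

/-- `Λ_K : L_K → Z`, the pull-back by `ζ_K` of the tautological bundle over `Gr(H^K)`: the fibre
over `s` is `ζ_K(s)`, so that the total space is `L_K = {(s, x) ∣ x ∈ ζ_K(s)}`. -/
abbrev LK : Z → Type _ := K.zeta *ᵖ (Taut K.RKHS)

instance (s : Z) : AddCommGroup (K.LK s) :=
  inferInstanceAs (AddCommGroup (K.zeta s).toSubmodule)

/-- `Ǩ : D → L_K`, `ξ ↦ (Π(ξ), K_ξ)`. -/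
def check (ξ : TotalSpace F D) : TotalSpace K.RKHS K.LK :=
  ⟨ξ.proj, (⟨K.hat ξ, K.hat_mem_zeta ξ⟩ : (K.zeta ξ.proj).toSubmodule)⟩

end ReproducingKernel

end LikeHerm

end

namespace LikeHerm

/-! The point is that evaluation at `s` extends to a bounded operator `ev : H^K → D_s`. By the
reproducing property, `(f(s) ∣ η) = (f ∣ K_η)` for `η` in the fibre over `s^{-*}`. The right-hand
side makes sense for every `f` in the completion and is a bounded antilinear functional of `η`, so
strong duality represents it by a vector of `D_s`, depending boundedly on `f` (`exists_eval`).

On the fibre `D_s` one has `ev ∘ K̂ = K(s,s)`. Hence `R = K(s,s)⁻¹ ∘ ev` is a bounded left inverse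
of `K̂` on `D_s` (`exists_leftInverse_hatFiber`). A bounded left inverse forces the range to be
closed, so `ζ_K(s) = K̂(D_s)`, and `R` restricted to `ζ_K(s)` is a two-sided inverse
(`hatFiber_apply_leftInverse`). -/

/-- Strong duality identifies `X` with a space of functionals, whose topology is compatible with
addition. For the fibres this permits checking continuity of linear maps at `0` only. -/
lemma IsStrongDualityPairing.isTopologicalAddGroup_left {X Y : Type*}
    [AddCommGroup X] [Module ℂ X] [TopologicalSpace X]
    [AddCommGroup Y] [Module ℂ Y] [TopologicalSpace Y]
    {B : X →ₗ[ℂ] Y →ₗ⋆[ℂ] ℂ} (hB : IsStrongDualityPairing B) : IsTopologicalAddGroup X := by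
  obtain ⟨T, -⟩ := hB.left
  exact T.toHomeomorph.isInducing.topologicalAddGroup T

namespace ReproducingKernel

variable {EB : Type*} [NormedAddCommGroup EB] [NormedSpace ℝ EB]
  {Z : Type*} [TopologicalSpace Z] [ChartedSpace EB Z]
  {F : Type*} [NormedAddCommGroup F] [NormedSpace ℂ F]
  {D : Z → Type*} [∀ z, AddCommGroup (D z)] [∀ z, Module ℂ (D z)]
  [∀ z, TopologicalSpace (D z)] [TopologicalSpace (TotalSpace F D)] [FiberBundle F D]
  {L : LikeHermitianStructure EB F D} (K : ReproducingKernel L)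

lemma inner_hat (ξ η : TotalSpace F D) :
    ⟪K.hat ξ, K.hat η⟫_ℂ = L.pairing (L.inv ξ.proj) ξ.proj (L.inv_inv _).symm
      (K.toFun (L.inv ξ.proj) η.proj η.snd) ξ.snd := by
  rw [hat, hat, UniformSpace.Completion.inner_coe, inner_preSec]

/-- The reproducing property at a point `s`, tested against the fibre over `inv s`. -/
lemma inner_hat_inv (s : Z) (η : D (L.inv s)) (ζ : TotalSpace F D) :
    ⟪K.hat ⟨L.inv s, η⟩, K.hat ζ⟫_ℂ =
      L.pairing s (L.inv s) rfl (K.toFun s ζ.proj ζ.snd) η := by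
  rw [inner_hat]
  -- `inv (inv s) = s` holds only propositionally, so the base point is generalized to a variable
  -- `w` that can be substituted.
  have transport : ∀ (w : Z) (hw : L.inv s = L.inv w), w = s →
      L.pairing w (L.inv s) hw (K.toFun w ζ.proj ζ.snd) η =
        L.pairing s (L.inv s) rfl (K.toFun s ζ.proj ζ.snd) η := by
    rintro w hw rfl; rfl
  exact transport _ _ (L.inv_inv s)

/-- Since `‖K_ξ‖² = (K(s^{-*}, s) ξ ∣ ξ)`, joint continuity of the pairing and boundedness of the
kernel operator make the norm of `K_ξ` continuous in `ξ`. It vanishes at `0`, which suffices by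
linearity. -/
lemma continuous_hatFiber (s : Z) : Continuous (K.hatFiber s) := by
  have hB := L.strong s (L.inv s) rfl
  have := hB.isTopologicalAddGroup_left
  refine continuous_of_continuousAt_zero (K.hatFiber s) ?_
  have hsq : Continuous fun ξ : D s => ‖K.hatFiber s ξ‖ ^ 2 := by
    have h (ξ : D s) : ‖K.hatFiber s ξ‖ ^ 2 = (L.pairing (L.inv s) s (L.inv_inv s).symm
        (K.toFun (L.inv s) s ξ) ξ).re := by
      rw [← inner_self_eq_norm_sq (𝕜 := ℂ)]
      exact congrArg Complex.re (K.inner_hat ⟨s, ξ⟩ ⟨s, ξ⟩)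
    simp only [h]
    exact Complex.continuous_re.comp ((L.strong (L.inv s) s (L.inv_inv s).symm).continuous.comp
      ((K.toFun (L.inv s) s).continuous.prodMk continuous_id))
  have hnorm : Continuous fun ξ : D s => ‖K.hatFiber s ξ‖ := by
    simpa [Function.comp_def] using Real.continuous_sqrt.comp hsq
  rw [ContinuousAt, map_zero, tendsto_zero_iff_norm_tendsto_zero]
  simpa using hnorm.tendsto 0

/-- The restriction of `K̂` to the fibre `D_s`, as a bounded linear operator. -/
noncomputable def hatFiberL (s : Z) : D s →L[ℂ] K.RKHS := ⟨K.hatFiber s, K.continuous_hatFiber s⟩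

/-- The bounded evaluation operator `H^K → D_s`, which extends `f ↦ f s` on `H₀^K`. -/
lemma exists_eval (s : Z) :
    ∃ ev : K.RKHS →L[ℂ] D s, ∀ ζ : TotalSpace F D, ev (K.hat ζ) = K.toFun s ζ.proj ζ.snd := by
  obtain ⟨T, hT⟩ := (L.strong s (L.inv s) rfl).left
  -- The composite sends `f` to the antilinear functional `⟪·, f⟫`, pulls it back along `K̂` to the
  -- fibre over `inv s`, and takes the vector of `D_s` representing it.
  refine ⟨(T.symm : (D (L.inv s) →L⋆[ℂ] ℂ) →L[ℂ] D s) ∘L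
    ContinuousLinearMap.precomp ℂ (K.hatFiberL (L.inv s)) ∘L innerSLFlip ℂ, fun ζ => ?_⟩
  refine T.injective ?_
  ext η
  simp only [ContinuousLinearMap.comp_apply, ContinuousLinearEquiv.coe_coe,
    ContinuousLinearEquiv.apply_symm_apply, hT]
  exact K.inner_hat_inv s η ζ

/-- If `K(s,s)` is invertible, then `K̂` on the fibre `D_s` has a bounded left inverse. -/
lemma exists_leftInverse_hatFiber {s : Z} (hK : (K.toFun s s).IsInvertible) :
    ∃ R : K.RKHS →L[ℂ] D s, ∀ ξ, R (K.hatFiberL s ξ) = ξ := by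
  obtain ⟨ev, hev⟩ := K.exists_eval s
  obtain ⟨A, hA⟩ := hK
  refine ⟨(A.symm : D s →L[ℂ] D s) ∘L ev, fun ξ => ?_⟩
  -- Evaluating the section `K_ξ = K(·, s) ξ` at `s` itself gives `K(s,s) ξ`.
  have h : ev (K.hatFiberL s ξ) = A ξ := by
    rw [← ContinuousLinearEquiv.coe_coe, hA]
    exact hev ⟨s, ξ⟩
  simp [h]

/-- If `K̂` on the fibre `D_s` has a bounded left inverse, then its range is closed, so that
`ζ_K(s) = K̂(D_s)`. -/
lemma hatFiber_apply_leftInverse {s : Z} {R : K.RKHS →L[ℂ] D s}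
    (hR : ∀ ξ, R (K.hatFiberL s ξ) = ξ) {x : K.RKHS} (hx : x ∈ (K.zeta s).toSubmodule) :
    K.hatFiberL s (R x) = x := by
  have hclosed : IsClosed {x | K.hatFiberL s (R x) = x} :=
    isClosed_eq ((K.hatFiberL s).continuous.comp R.continuous) continuous_id
  -- The fixed points of `K̂ ∘ R` form a closed set containing `K̂(D_s)`, hence also its closure.
  refine closure_minimal ?_ hclosed hx
  rintro _ ⟨ξ, rfl⟩
  exact congrArg (K.hatFiberL s) (hR ξ)

end ReproducingKernel

end LikeHerm

theorem corollary5p2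
    {EB : Type*} [NormedAddCommGroup EB] [NormedSpace ℝ EB] [CompleteSpace EB]
    {Z : Type*} [TopologicalSpace Z] [ChartedSpace EB Z] [IsManifold 𝓘(ℝ, EB) ∞ Z]
    {F : Type*} [NormedAddCommGroup F] [NormedSpace ℂ F] [CompleteSpace F]
    {D : Z → Type*} [∀ z, AddCommGroup (D z)] [∀ z, Module ℂ (D z)]
    [∀ z, TopologicalSpace (D z)] [TopologicalSpace (TotalSpace F D)] [FiberBundle F D]
    [VectorBundle ℂ F D] [VectorBundle ℝ F D] [ContMDiffVectorBundle ∞ F D 𝓘(ℝ, EB)]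
    (L : LikeHerm.LikeHermitianStructure EB F D) (K : LikeHerm.ReproducingKernel L)
    (hK : ∀ s : Z, (K.toFun s s).IsInvertible) :
    LikeHerm.IsBundleIso K.check (id : Z → Z) := by
  choose R hR using fun s => K.exists_leftInverse_hatFiber (hK s)
  refine ⟨fun s => ⟨(K.hatFiberL s).codRestrict (K.zeta s).toSubmodule
      fun ξ => K.hat_mem_zeta ⟨s, ξ⟩, fun ξ => rfl⟩,
    fun p => ⟨p.proj, R p.proj (p.snd : (K.zeta p.proj).toSubmodule).1⟩, id,
    fun s => ⟨(R s).comp (K.zeta s).toSubmodule.subtypeL, fun x => rfl⟩, ?_, ?_,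
    fun _ => rfl, fun _ => rfl⟩
  · rintro ⟨s, ξ⟩
    exact congrArg (TotalSpace.mk s) (hR s ξ)
  -- Here membership in `ζ_K(s)` matters: on all of `H^K`, `K̂ ∘ R` is only a projection onto
  -- `ζ_K(s)`.
  · rintro ⟨s, x⟩
    exact congrArg (TotalSpace.mk s) (Subtype.ext (K.hatFiber_apply_leftInverse (hR s) x.2))
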